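/- For every nonnegative integer $n$ let $$R_n=\sum_{k=0}^{n}\binom{n+k}{2k}\binom{2k}{k}\frac{1}{2k-1}.$$ Then, for every positive integer $n$, $$\sum_{k=0}^{n-1}(2k+1)R_k^2\equiv 0 \pmod{n},$$ and, for every odd prime $p$, $$\sum_{k=0}^{p-1}(2k+1)R_k^2\equiv 4p(-1)^{\frac{p-1}{2}}-p^2 \pmod{p^3}.$$ Here $a\equiv b \pmod m$ means that $a-b$ is an integer multiple of $m$. -/

import Mathlib

/-- The rational numbers `R_n = ∑_{k=0}^n C(n+k,2k) C(2k,k) / (2k-1)`; the denominator `2k-1` is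
taken in `ℚ`, so it is `-1` at `k = 0` and never vanishes. -/
def sunR (n : ℕ) : ℚ :=
  ∑ k ∈ Finset.range (n + 1),
    ((n + k).choose (2 * k) : ℚ) * ((2 * k).choose k : ℚ) * (1 / (2 * (k : ℚ) - 1))

/-! Write `D_n` for the central Delannoy number `P_n(3)`. Since `C(2k,k)/(2k-1)` is twice a Catalan
number for `k ≥ 1`, `R_n` is an integer; it obeys a first-order recurrence with inhomogeneous part
`D_n + D_{n+1}`, while `D_n` obeys Legendre's three-term recurrence. Together these sum `(2k+1)
R_k²` over `k < n` as `n / (8(2n+1)²)` times a form quadratic in `R_n`, `D_n`, `D_{n-1}`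
(`sqSum_closed_form`). Divisibility by `n` follows because `2n+1` is coprime to `n`, and parity
disposes of the 8. At `n = p` the form is needed modulo `p²`. Its leading part
`4(R_p+D_p)(D_p+D_{p-1})` needs both factors modulo `p²`; the next part carries a factor `p`, so
residues modulo `p` suffice. They come from `∏ (p²-l²)/l² ≡ (-1)^k` modulo `p²`. -/

namespace SunR

/-- The coefficient `C(n,k) C(n+k,k) = C(n+k,2k) C(2k,k)` of `x^k` in `P_n(1+2x)`. -/
def legCoeff (n k : ℕ) : ℤ := (n.choose k : ℤ) * ((n + k).choose k : ℤ)

theorem legCoeff_zero (n : ℕ) : legCoeff n 0 = 1 := by simp [legCoeff]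

theorem legCoeff_of_lt {n k : ℕ} (h : n < k) : legCoeff n k = 0 := by
  simp [legCoeff, Nat.choose_eq_zero_of_lt h]

theorem choose_succ_left (n k : ℕ) :
    ((n : ℤ) + 1 - k) * ((n + 1).choose k : ℤ) = (n + 1) * (n.choose k : ℤ) := by
  rcases le_or_gt k (n + 1) with h | h
  · have := Nat.choose_mul_succ_eq n k
    zify [h] at this
    linarith
  · simp [Nat.choose_eq_zero_of_lt h, Nat.choose_eq_zero_of_lt (show n < k by omega)]

theorem choose_succ_right (n k : ℕ) :
    ((k : ℤ) + 1) * (n.choose (k + 1) : ℤ) = (n - k) * (n.choose k : ℤ) := by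
  rcases le_or_gt k n with h | h
  · have := Nat.choose_succ_right_eq n k
    zify [h] at this
    linarith
  · simp [Nat.choose_eq_zero_of_lt h, Nat.choose_eq_zero_of_lt (show n < k + 1 by omega)]

theorem choose_succ_succ_mul (n k : ℕ) :
    ((k : ℤ) + 1) * ((n + 1).choose (k + 1) : ℤ) = (n + 1) * (n.choose k : ℤ) := by
  have := Nat.add_one_mul_choose_eq n k
  zify at this
  linarith

theorem legCoeff_succ_left (n k : ℕ) :
    ((n : ℤ) + 1 - k) * legCoeff (n + 1) k = (n + 1 + k) * legCoeff n k := by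
  have h1 := choose_succ_left n k
  have h2 := choose_succ_left (n + k) k
  rw [show n + k + 1 = n + 1 + k by ring] at h2
  push_cast at h2
  have h0 : ((n : ℤ) + 1) ≠ 0 := by positivity
  apply mul_left_cancel₀ h0
  unfold legCoeff
  linear_combination ((n : ℤ) + 1) * ((n + 1 + k).choose k : ℤ) * h1 +
    ((n : ℤ) + 1) * (n.choose k : ℤ) * h2

theorem legCoeff_succ_right (n k : ℕ) :
    ((k : ℤ) + 1) ^ 2 * legCoeff n (k + 1) = (n - k) * (n + k + 1) * legCoeff n k := by
  have h1 := choose_succ_right n k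
  have h2 := choose_succ_succ_mul (n + k) k
  push_cast at h2
  unfold legCoeff
  rw [show n + (k + 1) = n + k + 1 by ring]
  linear_combination ((k : ℤ) + 1) * ((n + k + 1).choose (k + 1) : ℤ) * h1 +
    ((n : ℤ) - k) * (n.choose k : ℤ) * h2

/-- The coefficient of `x^(k+1)` in Legendre's recurrence at `1 + 2x`. -/
theorem legCoeff_three_term (n k : ℕ) :
    ((n : ℤ) + 2) * legCoeff (n + 2) (k + 1) + (n + 1) * legCoeff n (k + 1)
      - (2 * n + 3) * legCoeff (n + 1) (k + 1) = 2 * (2 * n + 3) * legCoeff (n + 1) k := by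
  have a := legCoeff_succ_left n k
  have b := legCoeff_succ_left (n + 1) k
  have c := legCoeff_succ_right n k
  have d := legCoeff_succ_right (n + 1) k
  have e := legCoeff_succ_right (n + 2) k
  push_cast at b d e
  rw [show n + 1 + 1 = n + 2 by ring] at b
  have h0 : ((k : ℤ) + 1) ^ 2 ≠ 0 := by positivity
  apply mul_left_cancel₀ h0
  linear_combination ((n : ℤ) + 2) * e + ((n : ℤ) + 2) * (n + k + 3) * b + ((n : ℤ) + 1) * c
    - ((n : ℤ) + 1) * (n - k) * a - (2 * (n : ℤ) + 3) * d

/-! ### Integrality and recurrences -/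

/-- The integer `C(n,k) C(n+k,k) / (2k-1)`. -/
def term (n : ℕ) : ℕ → ℤ
  | 0 => -1
  | j + 1 => ((n + (j + 1)).choose (2 * (j + 1)) : ℤ) * (2 * (catalan j : ℤ))

theorem legCoeff_eq_choose (n k : ℕ) :
    legCoeff n k = ((n + k).choose (2 * k) : ℤ) * ((2 * k).choose k : ℤ) := by
  have := Nat.choose_mul (n := n + k) (k := 2 * k) (s := k) (by omega)
  rw [show n + k - k = n by omega, show 2 * k - k = k by omega] at this
  unfold legCoeff
  rw [mul_comm]
  exact_mod_cast this.symm

theorem mul_term (n k : ℕ) : (2 * (k : ℤ) - 1) * term n k = legCoeff n k := by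
  cases k with
  | zero => simp [term, legCoeff]
  | succ j =>
    have h1 := Nat.succ_mul_centralBinom_succ j
    rw [← succ_mul_catalan_eq_centralBinom j, Nat.centralBinom_eq_two_mul_choose] at h1
    have h2 : (2 * (j + 1)).choose (j + 1) = 2 * (2 * j + 1) * catalan j := by
      apply Nat.eq_of_mul_eq_mul_left (Nat.succ_pos j)
      rw [h1]; simp only [Nat.succ_eq_add_one]; ring
    rw [legCoeff_eq_choose, h2]
    simp only [term]
    push_cast
    ring

/-- The integer `R_n`. -/
def intR (n : ℕ) : ℤ := ∑ k ∈ Finset.range (n + 1), term n k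

/-- The central Delannoy number `P_n(3)`. -/
def delannoy (n : ℕ) : ℤ := ∑ k ∈ Finset.range (n + 1), legCoeff n k

theorem term_of_lt {n k : ℕ} (h : n < k) : term n k = 0 := by
  cases k with
  | zero => omega
  | succ j => simp [term, Nat.choose_eq_zero_of_lt (show n + (j + 1) < 2 * (j + 1) by omega)]

theorem delannoy_eq {n m : ℕ} (h : n < m) : delannoy n = ∑ k ∈ Finset.range m, legCoeff n k := by
  refine Finset.sum_subset (Finset.range_subset_range.2 h) fun k _ hk => ?_
  exact legCoeff_of_lt (by simpa using hk)

theorem intR_eq {n m : ℕ} (h : n < m) : intR n = ∑ k ∈ Finset.range m, term n k := by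
  refine Finset.sum_subset (Finset.range_subset_range.2 h) fun k _ hk => ?_
  exact term_of_lt (by simpa using hk)

theorem sunR_eq (n : ℕ) : sunR n = (intR n : ℚ) := by
  unfold sunR intR
  push_cast
  refine Finset.sum_congr rfl fun k _ => ?_
  have h0 : (2 * (k : ℚ) - 1) ≠ 0 := by
    intro h
    have : (2 * (k : ℤ) - 1) = 0 := by exact_mod_cast h
    omega
  have h := mul_term n k
  rw [legCoeff_eq_choose] at h
  have h' : (2 * (k : ℚ) - 1) * (term n k : ℚ) =
      ((n + k).choose (2 * k) : ℚ) * ((2 * k).choose k : ℚ) := by exact_mod_cast h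
  rw [← h']
  field_simp

/-- True term by term: multiplied by `2k-1`, it becomes twice `legCoeff_succ_left`. -/
theorem intR_succ (n : ℕ) :
    (2 * (n : ℤ) + 1) * intR (n + 1) = (2 * n + 3) * intR n + delannoy n + delannoy (n + 1) := by
  rw [intR_eq (show n < n + 2 by omega), delannoy_eq (show n < n + 2 by omega), intR, delannoy,
    Finset.mul_sum, Finset.mul_sum, ← Finset.sum_add_distrib, ← Finset.sum_add_distrib]
  refine Finset.sum_congr rfl fun k _ => ?_
  have h0 : (2 * (k : ℤ) - 1) ≠ 0 := by omega
  have h1 := mul_term n k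
  have h2 := mul_term (n + 1) k
  have h3 := legCoeff_succ_left n k
  apply mul_left_cancel₀ h0
  linear_combination (2 * (n : ℤ) + 1) * h2 - (2 * (n : ℤ) + 3) * h1 + 2 * h3

theorem delannoy_add_two (n : ℕ) :
    ((n : ℤ) + 2) * delannoy (n + 2) = 3 * (2 * n + 3) * delannoy (n + 1) - (n + 1) * delannoy n := by
  have key : ((n : ℤ) + 2) * delannoy (n + 2) + (n + 1) * delannoy n
      - (2 * n + 3) * delannoy (n + 1) = 2 * (2 * n + 3) * delannoy (n + 1) := by
    rw [delannoy_eq (show n + 2 < n + 2 + 1 by omega), delannoy_eq (show n < n + 2 + 1 by omega)]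
    conv_lhs => rw [delannoy_eq (show n + 1 < n + 2 + 1 by omega)]
    rw [Finset.sum_range_succ', Finset.sum_range_succ' (fun k => legCoeff n k),
      Finset.sum_range_succ' (fun k => legCoeff (n + 1) k)]
    simp only [legCoeff_zero]
    rw [show delannoy (n + 1) = ∑ k ∈ Finset.range (n + 2), legCoeff (n + 1) k from rfl]
    have : ∑ k ∈ Finset.range (n + 2), (((n : ℤ) + 2) * legCoeff (n + 2) (k + 1)
        + (n + 1) * legCoeff n (k + 1) - (2 * n + 3) * legCoeff (n + 1) (k + 1))
        = ∑ k ∈ Finset.range (n + 2), 2 * (2 * (n : ℤ) + 3) * legCoeff (n + 1) k :=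
      Finset.sum_congr rfl fun k _ => legCoeff_three_term n k
    simp only [Finset.sum_add_distrib, Finset.sum_sub_distrib, ← Finset.mul_sum] at this
    linear_combination this
  linear_combination key

/-! ### Closed form and divisibility by `n` -/

/-- The weighted sum of squares `∑_{k<n} (2k+1) R_k²`. -/
def sqSum (n : ℕ) : ℤ := ∑ k ∈ Finset.range n, (2 * (k : ℤ) + 1) * intR k ^ 2

theorem sqSum_closed_form (n : ℕ) :
    8 * (2 * (n : ℤ) + 3) ^ 2 * sqSum (n + 1) = (n + 1) *
      (4 * (intR (n + 1) + delannoy (n + 1)) * (delannoy (n + 1) + delannoy n)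
      + (n + 1) * (-8 * intR (n + 1) ^ 2 - 8 * intR (n + 1) * delannoy (n + 1)
        + 8 * intR (n + 1) * delannoy n + 7 * delannoy (n + 1) ^ 2
        + 6 * delannoy (n + 1) * delannoy n - delannoy n ^ 2)
      + 8 * (n + 1) ^ 2 * (2 * (n + 1) * intR (n + 1) ^ 2 - 3 * intR (n + 1) * delannoy (n + 1)
        + intR (n + 1) * delannoy n)) := by
  induction n with
  | zero => simp [sqSum, intR, delannoy, Finset.sum_range_succ, term, legCoeff]
  | succ n ih =>
    have hS : sqSum (n + 1 + 1) = sqSum (n + 1) + (2 * ((n + 1 : ℕ) : ℤ) + 1) * intR (n + 1) ^ 2 := by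
      rw [sqSum, Finset.sum_range_succ]; rfl
    have hR := intR_succ (n + 1)
    have hD := delannoy_add_two n
    rw [show n + 1 + 1 = n + 2 by ring] at *
    rw [hS]
    push_cast at *
    generalize intR (n + 1) = r at *
    generalize intR (n + 2) = r' at *
    generalize delannoy (n + 1) = d at *
    generalize delannoy (n + 2) = d' at *
    generalize delannoy n = d0 at *
    generalize sqSum (n + 1) = s at *
    have h0 : (0 : ℤ) < 2 * (n : ℤ) + 3 := by positivity
    generalize (n : ℤ) = x at *
    -- With this factor `r'` occurs only through `(2x+3) r'`, which `hR` eliminates; likewise `hD`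
    -- eliminates `(x+1) d0`. Squares are handled as `A² - B² = (A+B)(A-B)`.
    apply mul_left_cancel₀ (pow_ne_zero 2 h0.ne')
    linear_combination (2 * x + 5) ^ 2 * ih
      + (2 * x + 5) ^ 2 * (-((x + 1) * d0 + (3 * (2 * x + 3) * d - (x + 2) * d'))
        + (4 * (r + d) + (x + 1) * (8 * r + 6 * d) + 8 * (x + 1) ^ 2 * r)) * hD
      - ((-8 * (x + 2) ^ 2 + 16 * (x + 2) ^ 4) * ((2 * x + 3) * r' + ((2 * x + 5) * r + d + d'))
        + (x + 2) * (4 * (d' + d) + (x + 2) * (-8 * d' + 8 * d) + 8 * (x + 2) ^ 2 * (-3 * d' + d))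
          * (2 * x + 3)) * hR

theorem odd_delannoy (n : ℕ) : Odd (delannoy n) := by
  rw [delannoy, Finset.sum_range_succ', legCoeff_zero]
  refine Even.add_one ?_
  refine Finset.even_sum _ fun k _ => ?_
  rw [legCoeff_eq_choose, ← Nat.centralBinom_eq_two_mul_choose]
  refine Even.mul_left ?_ _
  exact_mod_cast (even_iff_two_dvd.2 (Nat.two_dvd_centralBinom_succ k))

theorem odd_intR (n : ℕ) : Odd (intR n) := by
  rw [intR, Finset.sum_range_succ']
  refine Even.add_odd ?_ (by simp [term])
  exact Finset.even_sum _ fun k _ => by simp [term]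

theorem dvd_sqSum (n : ℕ) (hn : 0 < n) : (n : ℤ) ∣ sqSum n := by
  obtain ⟨m, rfl⟩ : ∃ m, n = m + 1 := ⟨n - 1, by omega⟩
  have h := sqSum_closed_form m
  have hcop : IsCoprime ((m : ℤ) + 1) ((2 * (m : ℤ) + 3) ^ 2) :=
    IsCoprime.pow_right ⟨-2, 1, by ring⟩
  push_cast
  refine hcop.dvd_of_dvd_mul_left ?_
  obtain ⟨a, ha⟩ := odd_intR (m + 1)
  obtain ⟨b, hb⟩ := odd_delannoy (m + 1)
  obtain ⟨c, hc⟩ := odd_delannoy m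
  rcases Int.even_or_odd ((m : ℤ) + 1) with ⟨t, ht⟩ | hodd
  -- Here `n = 2t`. As `R` and `D` are odd, `R+D`, `D+D₀` and `7D-D₀` are even, and `7D²+6DD₀-D₀² =
  -- (7D-D₀)(D+D₀)`; so 8 divides the bracket.
  · refine ⟨2 * (a + b + 1) * (b + c + 1)
      + 2 * t * (-intR (m + 1) ^ 2 - intR (m + 1) * delannoy (m + 1) + intR (m + 1) * delannoy m)
      + t * (7 * b - c + 3) * (b + c + 1)
      + 4 * t ^ 2 * (4 * t * intR (m + 1) ^ 2 - 3 * intR (m + 1) * delannoy (m + 1)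
        + intR (m + 1) * delannoy m), ?_⟩
    apply mul_left_cancel₀ (show (8 : ℤ) ≠ 0 by norm_num)
    rw [← mul_assoc, h, ha, hb, hc, ht]
    ring
  · have h2 : IsCoprime ((m : ℤ) + 1) 8 := by
      have : IsCoprime ((m : ℤ) + 1) (2 ^ 3) :=
        IsCoprime.pow_right (Int.isCoprime_two_right.2 hodd)
      simpa using this
    refine h2.dvd_of_dvd_mul_left ?_
    rw [← mul_assoc, h]
    exact Dvd.intro _ rfl

/-! ### Congruences modulo `p²` -/

/-- The product `C(p-1,k) C(p+k,k) = ∏_{0<l≤k} (p²-l²)/l²`. -/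
def sqProd (p k : ℕ) : ℤ := ((p - 1).choose k : ℤ) * ((p + k).choose k : ℤ)

theorem sqProd_succ {p : ℕ} (hp : 0 < p) (k : ℕ) :
    ((k : ℤ) + 1) ^ 2 * sqProd p (k + 1) = ((p : ℤ) ^ 2 - (k + 1) ^ 2) * sqProd p k := by
  obtain ⟨q, rfl⟩ : ∃ q, p = q + 1 := ⟨p - 1, by omega⟩
  have h1 := choose_succ_right q k
  have h2 := choose_succ_succ_mul (q + 1 + k) k
  unfold sqProd
  rw [show q + 1 + (k + 1) = q + 1 + k + 1 by ring, show q + 1 - 1 = q by omega]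
  push_cast at *
  linear_combination ((k : ℤ) + 1) * ((q + 1 + k + 1).choose (k + 1) : ℤ) * h1 +
    ((q : ℤ) - k) * (q.choose k : ℤ) * h2

theorem legCoeff_eq_sqProd {p : ℕ} (hp : 0 < p) (k : ℕ) :
    ((k : ℤ) + 1) ^ 2 * legCoeff p (k + 1) = p * (p + k + 1) * sqProd p k := by
  obtain ⟨q, rfl⟩ : ∃ q, p = q + 1 := ⟨p - 1, by omega⟩
  have h1 := choose_succ_succ_mul q k
  have h2 := choose_succ_succ_mul (q + 1 + k) k
  unfold sqProd legCoeff
  rw [show q + 1 + (k + 1) = q + 1 + k + 1 by ring, show q + 1 - 1 = q by omega]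
  push_cast at *
  linear_combination ((k : ℤ) + 1) * ((q + 1 + k + 1).choose (k + 1) : ℤ) * h1 +
    ((q : ℤ) + 1) * (q.choose k : ℤ) * h2

theorem isCoprime_of_pos_lt {p k : ℕ} (hp : p.Prime) (h0 : 0 < k) (hk : k < p) :
    IsCoprime (p : ℤ) (k : ℤ) :=
  Nat.isCoprime_iff_coprime.2 (Nat.coprime_of_lt_prime h0.ne' hk hp)

/-- Each factor `(p²-l²)/l²` is `-1` modulo `p²`. -/
theorem sq_dvd_sqProd_sub {p : ℕ} (hp : p.Prime) (k : ℕ) (hk : k < p) :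
    (p : ℤ) ^ 2 ∣ sqProd p k - (-1) ^ k := by
  induction k with
  | zero => simp [sqProd]
  | succ k ih =>
    have hcop : IsCoprime ((p : ℤ) ^ 2) (((k : ℤ) + 1) ^ 2) := by
      have := isCoprime_of_pos_lt hp (Nat.succ_pos k) hk
      push_cast at this
      exact this.pow
    refine hcop.dvd_of_dvd_mul_left ?_
    obtain ⟨x, hx⟩ := ih (by omega)
    refine ⟨sqProd p k - ((k : ℤ) + 1) ^ 2 * x, ?_⟩
    linear_combination sqProd_succ hp.pos k - ((k : ℤ) + 1) ^ 2 * hx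

theorem dvd_legCoeff {p : ℕ} (hp : p.Prime) {k : ℕ} (hk : k + 1 < p) :
    (p : ℤ) ∣ legCoeff p (k + 1) :=
  Dvd.dvd.mul_right (by exact_mod_cast hp.dvd_choose_self (Nat.succ_ne_zero k) hk) _

theorem legCoeff_pred {p : ℕ} (hp : 0 < p) (k : ℕ) :
    ((p : ℤ) - k) * legCoeff p k = (p + k) * legCoeff (p - 1) k := by
  obtain ⟨q, rfl⟩ : ∃ q, p = q + 1 := ⟨p - 1, by omega⟩
  have := legCoeff_succ_left q k
  rw [show q + 1 - 1 = q by omega]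
  push_cast
  exact this

theorem dvd_legCoeff_pred {p : ℕ} (hp : p.Prime) {k : ℕ} (hk : k + 1 < p) :
    (p : ℤ) ∣ legCoeff (p - 1) (k + 1) := by
  have hcop := isCoprime_of_pos_lt hp (Nat.succ_pos k) hk
  obtain ⟨x, hx⟩ := dvd_legCoeff hp hk
  refine hcop.dvd_of_dvd_mul_left ?_
  have h := legCoeff_pred hp.pos (k + 1)
  refine ⟨(p - (k + 1)) * x - legCoeff (p - 1) (k + 1), ?_⟩
  push_cast at *
  linear_combination (p - ((k : ℤ) + 1)) * hx - h

/-- The sum is `2p/(p+k+1)` times `legCoeff p (k+1)`, itself a multiple of `p`. -/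
theorem sq_dvd_legCoeff_add {p : ℕ} (hp : p.Prime) {k : ℕ} (hk : k + 1 < p) :
    (p : ℤ) ^ 2 ∣ legCoeff p (k + 1) + legCoeff (p - 1) (k + 1) := by
  have hcop : IsCoprime ((p : ℤ) ^ 2) (((k : ℤ) + 1) ^ 2) := by
    have := isCoprime_of_pos_lt hp (Nat.succ_pos k) hk
    push_cast at this
    exact this.pow
  refine hcop.dvd_of_dvd_mul_left ⟨2 * sqProd p k, ?_⟩
  have h := legCoeff_pred hp.pos (k + 1)
  have h2 := legCoeff_eq_sqProd hp.pos k
  have h0 : ((p : ℤ) + k + 1) ≠ 0 := by positivity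
  apply mul_left_cancel₀ h0
  push_cast at h
  linear_combination 2 * (p : ℤ) * h2 - ((k : ℤ) + 1) ^ 2 * h

theorem legCoeff_self {p : ℕ} (hp : 0 < p) : legCoeff p p = 2 * sqProd p (p - 1) := by
  have h := legCoeff_eq_sqProd hp (p - 1)
  rw [Nat.sub_add_cancel hp] at h
  have hc : ((p - 1 : ℕ) : ℤ) = p - 1 := by push_cast [Nat.cast_sub hp]; ring
  rw [hc] at h
  have h0 : (p : ℤ) ^ 2 ≠ 0 := by positivity
  apply mul_left_cancel₀ h0
  linear_combination h

theorem sq_dvd_sqProd_pred_sub_one {p : ℕ} (hp : p.Prime) (hodd : Odd p) :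
    (p : ℤ) ^ 2 ∣ sqProd p (p - 1) - 1 := by
  have h := sq_dvd_sqProd_sub hp (p - 1) (by have := hp.pos; omega)
  rwa [Even.neg_one_pow (by obtain ⟨m, rfl⟩ := hodd; simp)] at h

theorem sq_dvd_delannoy_add_sub_four {p : ℕ} (hp : p.Prime) (hodd : Odd p) :
    (p : ℤ) ^ 2 ∣ delannoy p + delannoy (p - 1) - 4 := by
  obtain ⟨q, hq⟩ : ∃ q, p = q + 1 := ⟨p - 1, by have := hp.pos; omega⟩
  have h1 : delannoy p + delannoy (p - 1) =
      ∑ k ∈ Finset.range q, (legCoeff p (k + 1) + legCoeff (p - 1) (k + 1))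
        + legCoeff p p + 2 := by
    rw [delannoy_eq (show p - 1 < p + 1 by omega), delannoy, ← Finset.sum_add_distrib,
      Finset.sum_range_succ', hq, Finset.sum_range_succ, legCoeff_zero, legCoeff_zero,
      legCoeff_of_lt (show q + 1 - 1 < q + 1 by omega)]
    ring
  have h2 : (p : ℤ) ^ 2 ∣
      ∑ k ∈ Finset.range q, (legCoeff p (k + 1) + legCoeff (p - 1) (k + 1)) :=
    Finset.dvd_sum fun k hk =>
      sq_dvd_legCoeff_add hp (by have := Finset.mem_range.1 hk; omega)
  obtain ⟨x, hx⟩ := h2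
  obtain ⟨y, hy⟩ := sq_dvd_sqProd_pred_sub_one hp hodd
  refine ⟨x + 2 * y, ?_⟩
  rw [h1, legCoeff_self hp.pos]
  linear_combination hx + 2 * hy

theorem dvd_delannoy_pred_sub_one {p : ℕ} (hp : p.Prime) :
    (p : ℤ) ∣ delannoy (p - 1) - 1 := by
  rw [delannoy, Finset.sum_range_succ', legCoeff_zero, add_sub_cancel_right]
  exact Finset.dvd_sum fun k hk =>
    dvd_legCoeff_pred hp (by have := Finset.mem_range.1 hk; omega)

/-! ### The value of `R_p + D_p` modulo `p²` -/

/-- Makes the factor `p` explicit: for `k < p` it can be cancelled only when `2k+1 = p` or `k+1 =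
p`. -/
theorem term_add_legCoeff {p : ℕ} (hp : 0 < p) (k : ℕ) :
    (2 * (k : ℤ) + 1) * (k + 1) * (term p (k + 1) + legCoeff p (k + 1))
      = 2 * p * (p + k + 1) * sqProd p k := by
  have h1 := mul_term p (k + 1)
  have h2 := legCoeff_eq_sqProd hp k
  push_cast at h1
  linear_combination ((k : ℤ) + 1) * h1 + 2 * h2

/-- The summand at 0 is 2. The others cancel under `j ↦ 2m - j`, which preserves the sign and
negates the denominator, since `(2j+1) + (2(2m-j)+1) = 2p`. -/
theorem sum_neg_one_pow_div {p m : ℕ} [Fact p.Prime] (hm : 0 < m) (hpm : p = 2 * m + 1) :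
    ∑ j ∈ Finset.range (2 * m), ((2 : ZMod p) * (-1) ^ j / (2 * (j : ZMod p) + 1)) = 2 := by
  have h0 : ((2 * m + 1 : ℕ) : ZMod p) = 0 := by rw [← hpm]; exact ZMod.natCast_self _
  push_cast at h0
  obtain ⟨r, hr⟩ : ∃ r, 2 * m = r + 1 := ⟨2 * m - 1, by omega⟩
  rw [hr, Finset.sum_range_succ']
  have : ∑ j ∈ Finset.range r,
      ((2 : ZMod p) * (-1) ^ (j + 1) / (2 * ((j + 1 : ℕ) : ZMod p) + 1)) = 0 := by
    refine Finset.sum_involution (fun j _ => r - 1 - j) ?_ ?_ ?_ ?_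
    · intro j hj
      have hj := Finset.mem_range.1 hj
      have e1 : (2 * ((r - 1 - j + 1 : ℕ) : ZMod p) + 1) =
          -(2 * ((j + 1 : ℕ) : ZMod p) + 1) := by
        have : ((r - 1 - j + 1 : ℕ) : ZMod p) + ((j + 1 : ℕ) : ZMod p)
            = 2 * m := by
          rw [← Nat.cast_add, show r - 1 - j + 1 + (j + 1) = 2 * m by omega]
          push_cast; ring
        linear_combination 2 * this + 2 * h0
      have e2 : (-1 : ZMod p) ^ (r - 1 - j + 1) = (-1) ^ (j + 1) := by
        have : Even (r - 1 - j + 1 + (j + 1)) := ⟨m, by omega⟩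
        rcases Nat.even_or_odd (j + 1) with h | h
        · rw [h.neg_one_pow, ((Nat.even_add.1 this).2 h).neg_one_pow]
        · rw [h.neg_one_pow, ((Nat.even_add'.1 this).2 h).neg_one_pow]
      rw [e1, e2, div_neg, add_neg_cancel]
    · intro j hj hne heq
      have hj := Finset.mem_range.1 hj
      -- The fixed point has denominator `p = 0`, so its summand is 0 by the convention `x / 0 = 0`.
      apply hne
      have : j + 1 = m := by omega
      rw [this, h0, div_zero]
    · intro j hj
      have hj := Finset.mem_range.1 hj
      simp only [Finset.mem_range]; omega
    · intro j hj
      have hj := Finset.mem_range.1 hj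
      omega
  rw [this]
  simp

theorem dvd_term_add_legCoeff {p m j : ℕ} (hp : p.Prime) (hpm : p = 2 * m + 1) (hj : j < 2 * m)
    (hjm : j ≠ m) : (p : ℤ) ∣ term p (j + 1) + legCoeff p (j + 1) := by
  have hpz : Prime (p : ℤ) := Nat.prime_iff_prime_int.1 hp
  have h : (p : ℤ) ∣ ((2 * j + 1 : ℕ) : ℤ) * ((j + 1 : ℕ) : ℤ) *
      (term p (j + 1) + legCoeff p (j + 1)) := by
    push_cast
    rw [term_add_legCoeff hp.pos]
    exact ⟨2 * (p + j + 1) * sqProd p j, by ring⟩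
  rcases hpz.dvd_or_dvd h with h | h
  · rcases hpz.dvd_or_dvd h with h | h
    · obtain ⟨c, hc⟩ := Int.natCast_dvd_natCast.1 h
      have hc2 : c < 2 := by
        by_contra hlt
        have : p * 2 ≤ p * c := Nat.mul_le_mul_left _ (by omega)
        omega
      interval_cases c <;> omega
    · have := Nat.le_of_dvd (Nat.succ_pos j) (Int.natCast_dvd_natCast.1 h)
      omega
  · exact h

theorem term_add_legCoeff_div {p m j : ℕ} [Fact p.Prime] (hpm : p = 2 * m + 1) (hj : j < 2 * m)
    (hjm : j ≠ m) : (((term p (j + 1) + legCoeff p (j + 1)) / p : ℤ) : ZMod p) =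
      (2 : ZMod p) * (-1) ^ j / (2 * (j : ZMod p) + 1) := by
  have hp : p.Prime := Fact.out
  obtain ⟨f, hf⟩ := dvd_term_add_legCoeff hp hpm hj hjm
  have hp0 : (p : ℤ) ≠ 0 := by exact_mod_cast hp.ne_zero
  rw [hf, Int.mul_ediv_cancel_left _ hp0]
  have h := term_add_legCoeff hp.pos j
  have h1 : (2 * (j : ℤ) + 1) * (j + 1) * f = 2 * (p + j + 1) * sqProd p j := by
    apply mul_left_cancel₀ hp0
    linear_combination h - (2 * (j : ℤ) + 1) * (j + 1) * hf
  have hW : ((sqProd p j : ℤ) : ZMod p) = (-1) ^ j := by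
    have := (dvd_pow_self (p : ℤ) two_ne_zero).trans (sq_dvd_sqProd_sub hp j (by omega))
    rw [← ZMod.intCast_zmod_eq_zero_iff_dvd] at this
    push_cast at this
    exact sub_eq_zero.1 this
  have h2 := congrArg (Int.cast : ℤ → ZMod p) h1
  push_cast at h2
  rw [hW, ZMod.natCast_self] at h2
  have hj1 : ((j : ZMod p) + 1) ≠ 0 := by
    have : ((j + 1 : ℕ) : ZMod p) ≠ 0 := by
      rw [Ne, ZMod.natCast_eq_zero_iff]
      intro h
      have := Nat.le_of_dvd (Nat.succ_pos j) h
      omega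
    exact_mod_cast this
  have hj2 : (2 * (j : ZMod p) + 1) ≠ 0 := by
    have : ((2 * j + 1 : ℕ) : ZMod p) ≠ 0 := by
      rw [Ne, ZMod.natCast_eq_zero_iff]
      rintro ⟨c, hc⟩
      have hc2 : c < 2 := by
        by_contra hlt
        have : p * 2 ≤ p * c := Nat.mul_le_mul_left _ (by omega)
        omega
      interval_cases c <;> omega
    exact_mod_cast this
  rw [eq_div_iff hj2]
  apply mul_left_cancel₀ hj1
  linear_combination h2

theorem sq_dvd_intR_add_delannoy_sub {p m : ℕ} (hp : p.Prime) (hpm : p = 2 * m + 1) :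
    (p : ℤ) ^ 2 ∣ intR p + delannoy p - (2 * (-1) ^ m + 4 * (-1) ^ m * p - 2 * p) := by
  have := Fact.mk hp
  have hm : 0 < m := by
    rcases Nat.eq_zero_or_pos m with rfl | h
    · exact absurd hp (by norm_num [hpm])
    · exact h
  have hp0 : (p : ℤ) ≠ 0 := by exact_mod_cast hp.ne_zero
  have hpmz : (p : ℤ) = 2 * m + 1 := by exact_mod_cast hpm
  have hsum : intR p + delannoy p =
      ∑ j ∈ (Finset.range (2 * m)).erase m, (term p (j + 1) + legCoeff p (j + 1))
        + (term p (m + 1) + legCoeff p (m + 1)) + (term p p + legCoeff p p) := by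
    rw [Finset.sum_erase_add _ _ (Finset.mem_range.2 (by omega)), intR, delannoy,
      ← Finset.sum_add_distrib, Finset.sum_range_succ', legCoeff_zero]
    conv_lhs => rw [show Finset.range p = Finset.range (2 * m + 1) by rw [hpm]]
    rw [Finset.sum_range_succ, ← hpm]
    simp [term]
  -- the generic terms
  have hgen : ∃ f : ℤ, ∑ j ∈ (Finset.range (2 * m)).erase m,
      (term p (j + 1) + legCoeff p (j + 1)) = p * f ∧ (p : ℤ) ∣ f - 2 := by
    refine ⟨∑ j ∈ (Finset.range (2 * m)).erase m,
      (term p (j + 1) + legCoeff p (j + 1)) / p, ?_, ?_⟩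
    · rw [Finset.mul_sum]
      refine Finset.sum_congr rfl fun j hj => ?_
      rw [Finset.mem_erase, Finset.mem_range] at hj
      exact (Int.mul_ediv_cancel' (dvd_term_add_legCoeff hp hpm hj.2 hj.1)).symm
    · rw [← ZMod.intCast_zmod_eq_zero_iff_dvd]
      push_cast
      rw [sub_eq_zero]
      conv_rhs => rw [← sum_neg_one_pow_div (p := p) hm hpm]
      have hz : (2 * (m : ZMod p) + 1) = 0 := by
        have : ((2 * m + 1 : ℕ) : ZMod p) = 0 := by rw [← hpm]; exact ZMod.natCast_self _
        exact_mod_cast this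
      rw [← Finset.sum_erase (Finset.range (2 * m)) (a := m) (by rw [hz, div_zero])]
      refine Finset.sum_congr rfl fun j hj => ?_
      rw [Finset.mem_erase, Finset.mem_range] at hj
      exact term_add_legCoeff_div hpm hj.2 hj.1
  obtain ⟨f, hf, g, hg⟩ := hgen
  -- the term whose denominator is `p`
  have hmid : (p : ℤ) ^ 2 ∣ term p (m + 1) + legCoeff p (m + 1) - 2 * (-1) ^ m * (1 + 2 * p) := by
    obtain ⟨x, hx⟩ := sq_dvd_sqProd_sub hp m (by omega)
    have h := term_add_legCoeff hp.pos m
    -- At `k = m` the factor `2k+1 = p` cancels. The quotient is `2(3p+1)/(p+1) ≡ 2(1+2p)` modulo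
    -- `p²`, up to the sign `(-1)^m`.
    have h' : ((p : ℤ) + 1) * (term p (m + 1) + legCoeff p (m + 1))
        = 2 * (3 * p + 1) * sqProd p m := by
      apply mul_left_cancel₀ hp0
      linear_combination 2 * h + ((p : ℤ) * (term p (m + 1) + legCoeff p (m + 1))
        - 2 * p * sqProd p m) * hpmz
        + (term p (m + 1) + legCoeff p (m + 1)) * (2 * m + 2) * hpmz
    have hcop : IsCoprime ((p : ℤ) ^ 2) ((p : ℤ) + 1) := IsCoprime.pow_left ⟨-1, 1, by ring⟩
    refine hcop.dvd_of_dvd_mul_left ⟨2 * (3 * p + 1) * x - 4 * (-1) ^ m, ?_⟩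
    linear_combination h' + 2 * (3 * (p : ℤ) + 1) * hx
  -- the last term
  have hlast : (p : ℤ) ^ 2 ∣ term p p + legCoeff p p + 4 * p := by
    obtain ⟨x, hx⟩ := sq_dvd_sqProd_pred_sub_one hp ⟨m, hpm⟩
    have h := mul_term p p
    have h2 := legCoeff_self hp.pos
    have hcop : IsCoprime ((p : ℤ) ^ 2) (2 * (p : ℤ) - 1) :=
      IsCoprime.pow_left ⟨2, -1, by ring⟩
    refine hcop.dvd_of_dvd_mul_left ⟨4 * p * x + 8, ?_⟩
    linear_combination h + 2 * (p : ℤ) * h2 + 4 * (p : ℤ) * hx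
  obtain ⟨y, hy⟩ := hmid
  obtain ⟨z, hz⟩ := hlast
  refine ⟨g + y + z, ?_⟩
  rw [hsum]
  linear_combination hf + (p : ℤ) * hg + hy + hz

/-! ### The congruence modulo `p³` -/

theorem cube_dvd_sqSum_sub {p m : ℕ} (hp : p.Prime) (hpm : p = 2 * m + 1) :
    (p : ℤ) ^ 3 ∣ sqSum p - (4 * p * (-1) ^ m - p ^ 2) := by
  have hodd : Odd p := ⟨m, hpm⟩
  have h := sqSum_closed_form (p - 1)
  rw [Nat.sub_add_cancel hp.pos,
    show ((p - 1 : ℕ) : ℤ) = p - 1 by push_cast [Nat.cast_sub hp.pos]; ring] at h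
  obtain ⟨x, hx⟩ := sq_dvd_intR_add_delannoy_sub hp hpm
  obtain ⟨y, hy⟩ := sq_dvd_delannoy_add_sub_four hp hodd
  obtain ⟨z, hz⟩ := dvd_delannoy_pred_sub_one hp
  have hε : ((-1 : ℤ) ^ m) ^ 2 = 1 := by rw [← pow_mul, mul_comm, pow_mul]; norm_num
  have hcop : IsCoprime ((p : ℤ) ^ 3) (8 * (2 * (p : ℤ) + 1) ^ 2) := by
    refine IsCoprime.pow_left (IsCoprime.mul_right ?_ (IsCoprime.pow_right ⟨-2, 1, by ring⟩))
    have h2 : IsCoprime (p : ℤ) 2 := Int.isCoprime_two_right.2 (by exact_mod_cast hodd)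
    have : IsCoprime (p : ℤ) (2 ^ 3) := IsCoprime.pow_right h2
    simpa using this
  refine hcop.dvd_of_dvd_mul_left ?_
  generalize (-1 : ℤ) ^ m = ε at *
  generalize delannoy (p - 1) = d₀ at *
  generalize delannoy p = d at *
  generalize intR p = r at *
  generalize (p : ℤ) = q at *
  have hlin : q ^ 2 ∣ 4 * (r + d) * (d + d₀) - 16 * (2 * ε + 4 * ε * q - 2 * q) :=
    ⟨4 * x * (d + d₀) + 4 * (2 * ε + 4 * ε * q - 2 * q) * y, by
      linear_combination 4 * (d + d₀) * hx + 4 * (2 * ε + 4 * ε * q - 2 * q) * hy⟩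
  -- Modulo `q`, `d₀ ≡ 1`, `d ≡ 3`, `r ≡ 2ε - 3`; substituting with `ε² = 1` gives `24 + 64ε`.
  have hquad : q ∣ (-8 * r ^ 2 - 8 * r * d + 8 * r * d₀ + 7 * d ^ 2 + 6 * d * d₀ - d₀ ^ 2)
      - (24 + 64 * ε) := by
    have hd₀ : d₀ ≡ 1 [ZMOD q] := (Int.modEq_iff_dvd.2 ⟨z, hz⟩).symm
    have hd : d ≡ 3 [ZMOD q] := (Int.modEq_iff_dvd.2 ⟨q * y - z, by
      linear_combination hy - hz⟩).symm
    have hr : r ≡ 2 * ε - 3 [ZMOD q] := (Int.modEq_iff_dvd.2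
      ⟨q * x + 4 * ε - 2 - (q * y - z), by linear_combination hx - hy + hz⟩).symm
    have := ((((((hr.pow 2).mul_left (-8)).sub ((hr.mul_left 8).mul hd)).add
      ((hr.mul_left 8).mul hd₀)).add ((hd.pow 2).mul_left 7)).add ((hd.mul_left 6).mul hd₀)).sub
      (hd₀.pow 2)
    have := this.symm.dvd
    convert this using 2
    linear_combination 32 * hε
  obtain ⟨a, ha⟩ := hlin
  obtain ⟨b, hb⟩ := hquad
  refine ⟨a + b + 8 * (2 * q * r ^ 2 - 3 * r * d + r * d₀)
    + 32 - 128 * ε + 32 * q, ?_⟩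
  linear_combination h + q * ha + q ^ 2 * hb

end SunR

theorem theorem1 :
    (∀ n : ℕ, 0 < n →
      ∑ k ∈ Finset.range n, (2 * (k : ℚ) + 1) * sunR k ^ 2 ≡ 0 [PMOD (n : ℚ)]) ∧
    (∀ p : ℕ, p.Prime → Odd p →
      ∑ k ∈ Finset.range p, (2 * (k : ℚ) + 1) * sunR k ^ 2
        ≡ 4 * (p : ℚ) * (-1) ^ ((p - 1) / 2) - (p : ℚ) ^ 2 [PMOD ((p : ℚ) ^ 3)]) := by
  have hcast : ∀ n : ℕ, ∑ k ∈ Finset.range n, (2 * (k : ℚ) + 1) * sunR k ^ 2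
      = (SunR.sqSum n : ℚ) := fun n => by
    simp only [SunR.sunR_eq, SunR.sqSum]
    push_cast
    rfl
  constructor
  · intro n hn
    obtain ⟨c, hc⟩ := SunR.dvd_sqSum n hn
    rw [hcast, hc, AddCommGroup.modEq_iff_zsmul]
    refine ⟨-c, ?_⟩
    push_cast [zsmul_eq_mul]
    ring
  · rintro p hp ⟨m, hm⟩
    obtain ⟨c, hc⟩ := SunR.cube_dvd_sqSum_sub hp hm
    have hc' : (SunR.sqSum p : ℚ) - (4 * p * (-1) ^ m - p ^ 2) = p ^ 3 * c := by exact_mod_cast hc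
    rw [hcast, AddCommGroup.modEq_iff_zsmul, show (p - 1) / 2 = m by omega]
    refine ⟨-c, ?_⟩
    push_cast [zsmul_eq_mul]
    linear_combination hc'
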